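/- Let $\mathcal F$ be the singular foliation of $\mathbb C^3$ defined by the vector field $$X = x(1+x^2yz^3)\,\partial_x + y(1-x^2yz^3)\,\partial_y - z\,\partial_z .$$ A holomorphic first integral on an open set $U$ is a holomorphic function $F:U\to\mathbb C$ with $dF(X)=0$ on $U$; two first integrals $F,G$ on a connected open set are independent if $dF\wedge dG\not\equiv 0$. Let $\mathrm{Diff}(\mathbb C^2,0)$ be the group of germs of local holomorphic diffeomorphisms of $\mathbb C^2$ fixing the origin. A germ $h\in \mathrm{Diff}(\mathbb C^2,0)$ has finite orbits if there is an open neighbourhood $V$ of $0$, on which $h$ and $h^{-1}$ have injective holomorphic representatives, such that every orbit in $V$ is finite, the orbit of $p\in V$ being the set of points reached from $p$ by successive applications of $h^{\pm1}$ with all successive points in $V$. Then: (i) On no connected open neighbourhood of the origin does $\mathcal F$ have two independent holomorphic first integrals; it does have a holomorphic first integral on all of $\mathbb C^3$ that is non-constant on every neighbourhood of the origin. (ii) Let $h\in\mathrm{Diff}(\mathbb C^2,0)$ be the holonomy germ of $\mathcal F$ along the $z$-axis $\{x=y=0\}$, on the transversal $\{z=1\}$, for the loop $z=e^{2\pi i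 t}$, $0\le t\le 1$; the holonomy germ of the reversed loop $z=e^{-2\pi i t}$ is $h^{-1}$. Both have the form $$(x,y)\mapsto\left(x\,(1+x^2y\,f(x^2y)),\; y\,(1+x^2y\,f(x^2y))^{-1}\right)$$ near the origin, with $f$ a function of one variable holomorphic near $0$, where $f(0)=-2\pi i$ for $h$ and $f(0)=2\pi i$ for $h^{-1}$. (iii) $h$ and $h^{-1}$ have finite orbits, but $h$ is not periodic (no power $h^k$, $k\ge1$, is the identity germ) and the subgroup of $\mathrm{Diff}(\mathbb C^2,0)$ generated by $h$ is infinite. -/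

import Mathlib

open Set Filter Topology

noncomputable section

/-! ### Germs of local holomorphic diffeomorphisms fixing the origin -/

section Germs

variable (E : Type*) [NormedAddCommGroup E] [NormedSpace ℂ E]

/-- Maps that are holomorphic near `0` and fix `0`. -/
abbrev LocalHolMap : Type _ := {f : E → E // AnalyticAt ℂ f 0 ∧ f 0 = 0}

/-- Two such maps are identified when they agree on a neighbourhood of `0`. -/
instance LocalHolMap.setoid : Setoid (LocalHolMap E) where
  r f g := f.1 =ᶠ[𝓝 0] g.1
  iseqv := ⟨fun _ => EventuallyEq.rfl, fun h => h.symm, fun h₁ h₂ => h₁.trans h₂⟩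

/-- Germs at `0` of holomorphic maps fixing `0`. -/
def HolGerm : Type _ := Quotient (LocalHolMap.setoid E)

variable {E}

/-- Composition of representatives. -/
def LocalHolMap.comp (f g : LocalHolMap E) : LocalHolMap E :=
  ⟨f.1 ∘ g.1,
    AnalyticAt.comp (by rw [g.2.2]; exact f.2.1) g.2.1,
    by simp only [Function.comp_apply, g.2.2, f.2.2]⟩

/-- Germs form a monoid under composition. -/
instance HolGerm.instMonoid : Monoid (HolGerm E) where
  mul := Quotient.map₂ LocalHolMap.comp (by
    intro f f' hf g g' hg
    have ht : Tendsto g.1 (𝓝 0) (𝓝 0) := by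
      have h := g.2.1.continuousAt.tendsto
      rwa [g.2.2] at h
    have h1 : ∀ᶠ x in 𝓝 (0 : E), f.1 (g.1 x) = f'.1 (g.1 x) := ht.eventually hf
    have h2 : ∀ᶠ x in 𝓝 (0 : E), g.1 x = g'.1 x := hg
    show ∀ᶠ x in 𝓝 (0 : E), f.1 (g.1 x) = f'.1 (g'.1 x)
    filter_upwards [h1, h2] with x hx1 hx2
    rw [hx1, hx2])
  one := Quotient.mk _ ⟨id, analyticAt_id, rfl⟩
  mul_assoc := by rintro ⟨f⟩ ⟨g⟩ ⟨k⟩; rfl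
  one_mul := by rintro ⟨f⟩; rfl
  mul_one := by rintro ⟨f⟩; rfl

variable (E) in
/-- The group `Diff(E, 0)` of germs of local holomorphic diffeomorphisms of `E` fixing the origin:
the germs that are invertible under composition. -/
abbrev DiffGerm : Type _ := (HolGerm E)ˣ

/-- The map `φ` is a representative of the germ `h`. -/
def DiffGerm.IsRepresentedBy (h : DiffGerm E) (φ : E → E) : Prop :=
  ∃ hφ : AnalyticAt ℂ φ 0 ∧ φ 0 = 0, h.val = Quotient.mk (LocalHolMap.setoid E) ⟨φ, hφ⟩

/-- The orbit of `p` under the pseudogroup on `V` generated by `φ` and its inverse `ψ`: all points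
obtained from `p` by words in `φ`, `ψ` whose successive images stay in `V`. -/
def pseudoOrbit (V : Set E) (φ ψ : E → E) (p : E) : Set E :=
  {q | Relation.ReflTransGen (fun a b => b ∈ V ∧ (b = φ a ∨ b = ψ a)) p q}

/-- The germ `h` has finite orbits: on some open neighbourhood `V` of the origin on which `h` and
its inverse are represented by injective holomorphic maps, inverse to each other as long as points
stay in `V`, every orbit of the pseudogroup generated by `h` on `V` is finite. -/
def DiffGerm.HasFiniteOrbits (h : DiffGerm E) : Prop :=
  ∃ (V : Set E) (φ ψ : E → E), IsOpen V ∧ (0 : E) ∈ V ∧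
    h.IsRepresentedBy φ ∧ h⁻¹.IsRepresentedBy ψ ∧
    DifferentiableOn ℂ φ V ∧ DifferentiableOn ℂ ψ V ∧ InjOn φ V ∧ InjOn ψ V ∧
    (∀ p ∈ V, φ p ∈ V → ψ (φ p) = p) ∧ (∀ p ∈ V, ψ p ∈ V → φ (ψ p) = p) ∧
    ∀ p ∈ V, (pseudoOrbit V φ ψ p).Finite

end Germs

/-! ### Foliations by curves on `ℂ³`: first integrals and holonomy along the third axis -/

/-- `F` is a holomorphic function on `U`, constant along the leaves of the foliation of `X`,
that is `dF(X) = 0`. (Constant functions are allowed.) -/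
def IsFirstIntegralOn (X : ℂ × ℂ × ℂ → ℂ × ℂ × ℂ) (U : Set (ℂ × ℂ × ℂ))
    (F : ℂ × ℂ × ℂ → ℂ) : Prop :=
  DifferentiableOn ℂ F U ∧ ∀ p ∈ U, fderiv ℂ F p (X p) = 0

/-- The 2-form `dF ∧ dG` does not vanish identically on `U` (for connected `U`). -/
def IndependentOn (U : Set (ℂ × ℂ × ℂ)) (F G : ℂ × ℂ × ℂ → ℂ) : Prop :=
  ∃ p ∈ U, LinearIndependent ℂ ![fderiv ℂ F p, fderiv ℂ G p]

/-- `h` is the holonomy germ, for the foliation of `X`, of the loop `t ↦ (0, 0, γ t)`, `t ∈ [0,1]`,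
in the third axis, on the transversal `{z = γ 0} ≃ ℂ²`. For `p` near `0`,
`t ↦ (Γ p t, γ t)` is the lift of the loop to the leaf through `(p, γ 0)` (its velocity is a
multiple of `X`), the lifts depend continuously on `p`, the lift of `p = 0` is the loop itself,
and the lift of `p` ends at `(h p, γ 1)`. -/
def IsHolonomyGerm (X : ℂ × ℂ × ℂ → ℂ × ℂ × ℂ) (γ : ℝ → ℂ) (h : DiffGerm (ℂ × ℂ)) : Prop :=
  ∃ (φ : ℂ × ℂ → ℂ × ℂ) (V : Set (ℂ × ℂ)) (Γ : ℂ × ℂ → ℝ → ℂ × ℂ),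
    h.IsRepresentedBy φ ∧ V ∈ 𝓝 (0 : ℂ × ℂ) ∧
    ContinuousOn (fun q : (ℂ × ℂ) × ℝ => Γ q.1 q.2) (V ×ˢ Icc (0 : ℝ) 1) ∧
    (∀ t ∈ Icc (0 : ℝ) 1, Γ 0 t = 0) ∧
    ∀ p ∈ V, Γ p 0 = p ∧ Γ p 1 = φ p ∧
      ∀ t ∈ Icc (0 : ℝ) 1, ∃ c : ℂ,
        HasDerivWithinAt (fun s : ℝ => ((Γ p s).1, (Γ p s).2, γ s))
          (c • X ((Γ p t).1, (Γ p t).2, γ t)) (Icc (0 : ℝ) 1) t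

/-- The vector field
`x(1 + x²yz³) ∂/∂x + y(1 - x²yz³) ∂/∂y - z ∂/∂z` on `ℂ³`. -/
def fieldX : ℂ × ℂ × ℂ → ℂ × ℂ × ℂ := fun p =>
  (p.1 * (1 + p.1 ^ 2 * p.2.1 * p.2.2 ^ 3),
   p.2.1 * (1 - p.1 ^ 2 * p.2.1 * p.2.2 ^ 3),
   -p.2.2)

/-- The germ `h` is `(x, y) ↦ (x(1 + x²y f(x²y)), y(1 + x²y f(x²y))⁻¹)` near the origin, for some
function `f` holomorphic near `0 ∈ ℂ` with `f 0 = a`. -/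
def HasShearForm (h : DiffGerm (ℂ × ℂ)) (a : ℂ) : Prop :=
  ∃ f : ℂ → ℂ, AnalyticAt ℂ f 0 ∧ f 0 = a ∧
    h.IsRepresentedBy (fun p : ℂ × ℂ =>
      (p.1 * (1 + p.1 ^ 2 * p.2 * f (p.1 ^ 2 * p.2)),
       p.2 * (1 + p.1 ^ 2 * p.2 * f (p.1 ^ 2 * p.2))⁻¹))

end

noncomputable section

/-! Everything rests on the monomial `w = x²yz³`: its linear weights `2 + 1 - 3` cancel, so `X(w) =
w²` and `w` evolves as `w / (1 - wτ)`. The flow is therefore explicit: linear flow composed with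
division of `x` and multiplication of `y` by `1 - wτ`. Since `z = exp(-τ)` along it, the holonomy of
a loop around the axis is the shear `(x / (1 - cu), y (1 - cu))` with `u = x²y` and `c = ∓2πi`
(`isHolonomyGerm_iff`).

The shears form a one-parameter group, so the `n`-th iterate has parameter `nc`. It is never the
identity for `n ≠ 0`. Points with `u = 0` are fixed; for the others `y (1 - ncu)` is unbounded in
`n`, so orbits leave `‖y‖ < 1` (`hasFiniteOrbits_shearGerm`).

The function `xyz²` is a first integral. There is no second independent one because any first
integral is invariant under all iterates of the holonomy. Many turns at small `(x, y)`, combined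
with the identity theorem in a scaling variable, upgrade this to invariance under a continuous
family of diagonal maps (`IsFirstIntegralOn.comp_diagShear`). Hence `dF` kills `x∂x - y∂y` as well
as `X`, which near the origin and off the coordinate planes leaves only multiples of `d(xyz²)`. So
`dF ∧ dG` vanishes on a small open set, and then on all of the connected `U`
(`wedge_fderiv_eq_zero`). -/

/-! ### The one-parameter group of shears -/

/-- The time-`c` map of the vector field `x²y (x ∂/∂x - y ∂/∂y)` of the plane. -/
def shearMap (c : ℂ) (p : ℂ × ℂ) : ℂ × ℂ :=
  (p.1 / (1 - c * (p.1 ^ 2 * p.2)), p.2 * (1 - c * (p.1 ^ 2 * p.2)))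

theorem shearMap_origin (c : ℂ) : shearMap c 0 = 0 := by simp [shearMap]

theorem shearMap_zero (p : ℂ × ℂ) : shearMap 0 p = p := by simp [shearMap]

theorem shearMap_invariant {c : ℂ} {p : ℂ × ℂ} (h : 1 - c * (p.1 ^ 2 * p.2) ≠ 0) :
    (shearMap c p).1 ^ 2 * (shearMap c p).2 = p.1 ^ 2 * p.2 / (1 - c * (p.1 ^ 2 * p.2)) := by
  simp only [shearMap]
  generalize 1 - c * (p.1 ^ 2 * p.2) = m at h ⊢
  field_simp

/-- The shear moves `u = x²y` by the parabolic map `u ↦ u / (1 - cu)`, a translation of `-1/u` by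
`c`; this is why parameters add under composition. -/
theorem one_sub_shearMap_invariant {c : ℂ} (d : ℂ) {p : ℂ × ℂ}
    (h : 1 - c * (p.1 ^ 2 * p.2) ≠ 0) :
    1 - d * ((shearMap c p).1 ^ 2 * (shearMap c p).2) =
      (1 - (c + d) * (p.1 ^ 2 * p.2)) / (1 - c * (p.1 ^ 2 * p.2)) := by
  rw [shearMap_invariant h, eq_div_iff h, sub_mul, mul_assoc, div_mul_cancel₀ _ h]
  ring

theorem shearMap_shearMap {c : ℂ} (d : ℂ) {p : ℂ × ℂ} (h : 1 - c * (p.1 ^ 2 * p.2) ≠ 0) :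
    shearMap d (shearMap c p) = shearMap (c + d) p := by
  rw [shearMap, one_sub_shearMap_invariant d h]
  ext
  · simp only [shearMap]
    rw [div_div_div_cancel_right₀ h]
  · simp only [shearMap]
    rw [mul_assoc, mul_div_cancel₀ _ h]

theorem eventually_one_sub_ne_zero (c : ℂ) :
    ∀ᶠ p : ℂ × ℂ in 𝓝 0, 1 - c * (p.1 ^ 2 * p.2) ≠ 0 := by
  have h : ContinuousAt (fun p : ℂ × ℂ => 1 - c * (p.1 ^ 2 * p.2)) 0 := by fun_prop
  exact h.eventually_ne (by simp)

theorem analyticAt_shearMap (c : ℂ) : AnalyticAt ℂ (shearMap c) 0 := by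
  have h1 : AnalyticAt ℂ (fun p : ℂ × ℂ => p.1) 0 := analyticAt_fst
  have h2 : AnalyticAt ℂ (fun p : ℂ × ℂ => p.2) 0 := analyticAt_snd
  have h3 : AnalyticAt ℂ (fun p : ℂ × ℂ => 1 - c * (p.1 ^ 2 * p.2)) 0 :=
    analyticAt_const.sub (analyticAt_const.mul ((h1.pow 2).mul h2))
  exact (h1.div h3 (by simp)).prod (h2.mul h3)

/-- The map `shearMap c` as a holomorphic germ. -/
def shearHolGerm (c : ℂ) : HolGerm (ℂ × ℂ) :=
  Quotient.mk (LocalHolMap.setoid (ℂ × ℂ)) ⟨shearMap c, analyticAt_shearMap c, shearMap_origin c⟩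

theorem shearHolGerm_mul (c d : ℂ) : shearHolGerm d * shearHolGerm c = shearHolGerm (c + d) := by
  refine Quotient.sound ?_
  show ∀ᶠ p in 𝓝 (0 : ℂ × ℂ), shearMap d (shearMap c p) = shearMap (c + d) p
  filter_upwards [eventually_one_sub_ne_zero c] with p hp using shearMap_shearMap d hp

theorem shearHolGerm_zero : shearHolGerm 0 = 1 := by
  refine Quotient.sound ?_
  show ∀ᶠ p in 𝓝 (0 : ℂ × ℂ), shearMap 0 p = p
  exact Eventually.of_forall shearMap_zero

/-- The germ at the origin of `shearMap c`. -/
def shearGerm (c : ℂ) : DiffGerm (ℂ × ℂ) where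
  val := shearHolGerm c
  inv := shearHolGerm (-c)
  val_inv := by rw [shearHolGerm_mul, neg_add_cancel, shearHolGerm_zero]
  inv_val := by rw [shearHolGerm_mul, add_neg_cancel, shearHolGerm_zero]

theorem shearGerm_inv (c : ℂ) : (shearGerm c)⁻¹ = shearGerm (-c) :=
  Units.ext rfl

theorem shearGerm_pow (c : ℂ) (k : ℕ) : shearGerm c ^ k = shearGerm (k * c) := by
  induction k with
  | zero =>
    rw [pow_zero, Nat.cast_zero, zero_mul]
    exact Units.ext shearHolGerm_zero.symm
  | succ k ih =>
    rw [pow_succ, ih]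
    refine Units.ext ?_
    show shearHolGerm (k * c) * shearHolGerm c = shearHolGerm ((k + 1 : ℕ) * c)
    rw [shearHolGerm_mul]
    congr 1
    push_cast
    ring

theorem isRepresentedBy_shearGerm_iff {c : ℂ} {g : DiffGerm (ℂ × ℂ)} :
    g.IsRepresentedBy (shearMap c) ↔ g = shearGerm c :=
  ⟨fun ⟨_, h⟩ => Units.ext h, fun h => ⟨⟨analyticAt_shearMap c, shearMap_origin c⟩, by rw [h]; rfl⟩⟩

theorem DiffGerm.IsRepresentedBy.congr {E : Type*} [NormedAddCommGroup E] [NormedSpace ℂ E]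
    {g : DiffGerm E} {φ ψ : E → E} (h : g.IsRepresentedBy φ) (hφψ : φ =ᶠ[𝓝 0] ψ) :
    g.IsRepresentedBy ψ := by
  obtain ⟨hφ, hg⟩ := h
  refine ⟨⟨hφ.1.congr hφψ, hφψ.eq_of_nhds ▸ hφ.2⟩, hg.trans (Quotient.sound ?_)⟩
  exact hφψ

theorem shearGerm_eq_one_iff {c : ℂ} : shearGerm c = 1 ↔ c = 0 := by
  constructor
  · intro h
    have h1 : shearHolGerm c = 1 := congrArg Units.val h
    have h2 : ∀ᶠ p in 𝓝 (0 : ℂ × ℂ), shearMap c p = p := Quotient.exact h1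
    have hcont : Continuous fun t : ℂ => (t, t) := by fun_prop
    have ht : Tendsto (fun t : ℂ => (t, t)) (𝓝[≠] 0) (𝓝 (0 : ℂ × ℂ)) :=
      (hcont.tendsto' 0 0 rfl).mono_left nhdsWithin_le_nhds
    obtain ⟨t, ht1, ht0⟩ := ((ht.eventually h2).and self_mem_nhdsWithin).exists
    have ht0 : t ≠ 0 := ht0
    -- On the diagonal `u = t³`, and the second coordinate alone already detects `c`.
    have h3 : t * (1 - c * (t ^ 2 * t)) = t := congrArg Prod.snd ht1
    have h4 : c * t ^ 4 = 0 := by linear_combination -h3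
    simpa [ht0] using h4
  · rintro rfl
    exact Units.ext shearHolGerm_zero

theorem not_isOfFinOrder_shearGerm {c : ℂ} (hc : c ≠ 0) : ¬ IsOfFinOrder (shearGerm c) := by
  rw [isOfFinOrder_iff_pow_eq_one]
  rintro ⟨k, hk, h⟩
  rw [shearGerm_pow, shearGerm_eq_one_iff] at h
  simp [hc, hk.ne'] at h

theorem hasShearForm_shearGerm (c : ℂ) : HasShearForm (shearGerm c) c := by
  -- This `f` solves `1 + u f(u) = 1 / (1 - cu)`.
  refine ⟨fun u => c / (1 - c * u), AnalyticAt.div (by fun_prop) (by fun_prop) (by simp),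
    by simp, (isRepresentedBy_shearGerm_iff.2 rfl).congr ?_⟩
  filter_upwards [eventually_one_sub_ne_zero c] with p hp
  have h : 1 + p.1 ^ 2 * p.2 * (c / (1 - c * (p.1 ^ 2 * p.2))) = (1 - c * (p.1 ^ 2 * p.2))⁻¹ := by
    generalize p.1 ^ 2 * p.2 = u at hp ⊢
    refine eq_inv_of_mul_eq_one_left ?_
    rw [add_mul, mul_assoc, div_mul_cancel₀ _ hp]
    ring
  rw [h, inv_inv]
  rfl

/-- An orbit of the iterates of a shear meets the region `‖y‖ < 1` in a finite set. -/
theorem finite_setOf_shearMap_int {c : ℂ} (hc : c ≠ 0) (p : ℂ × ℂ) :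
    {q | ∃ n : ℤ, q = shearMap (n * c) p ∧ ‖q.2‖ < 1}.Finite := by
  rcases eq_or_ne (p.1 ^ 2 * p.2) 0 with hu | hu
  · refine (finite_singleton p).subset ?_
    rintro q ⟨n, rfl, -⟩
    simp [shearMap, hu]
  · have hy : p.2 ≠ 0 := right_ne_zero_of_mul hu
    set m : ℝ := ‖p.2 * (c * (p.1 ^ 2 * p.2))‖ with hm
    have hm0 : 0 < m := norm_pos_iff.2 (mul_ne_zero hy (mul_ne_zero hc hu))
    obtain ⟨N, hN⟩ := exists_nat_gt ((1 + ‖p.2‖) / m)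
    refine ((finite_Icc (-(N : ℤ)) N).image fun n : ℤ => shearMap (n * c) p).subset ?_
    rintro q ⟨n, rfl, hn⟩
    refine ⟨n, ?_, rfl⟩
    -- The second coordinate moves affinely in `n`, with step of norm `m`, so the region `‖y‖ < 1`
    -- bounds `n`.
    have h1 : ‖(n : ℂ)‖ * m < 1 + ‖p.2‖ := by
      rw [hm, ← norm_mul]
      have h2 : (n : ℂ) * (p.2 * (c * (p.1 ^ 2 * p.2))) = p.2 - (shearMap (n * c) p).2 := by
        simp only [shearMap]
        ring
      rw [h2]
      exact (norm_sub_le _ _).trans_lt (by linarith)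
    have h3 : |(n : ℝ)| < N := by
      rw [Complex.norm_intCast] at h1
      exact ((lt_div_iff₀ hm0).2 h1).trans hN
    have h4 : |n| < N := by exact_mod_cast h3
    exact abs_le.1 h4.le

theorem hasFiniteOrbits_shearGerm {c : ℂ} (hc : c ≠ 0) : (shearGerm c).HasFiniteOrbits := by
  -- The first inequality is the one that orbits eventually violate; the second keeps the
  -- denominators of both `shearMap c` and `shearMap (-c)` nonzero.
  set V : Set (ℂ × ℂ) := {p | ‖p.2‖ < 1 ∧ ‖c * (p.1 ^ 2 * p.2)‖ < 1} with hV
  have hne : ∀ p ∈ V, 1 - c * (p.1 ^ 2 * p.2) ≠ 0 := by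
    intro p hp h
    have h1 := hp.2
    rw [← sub_eq_zero.1 h, norm_one] at h1
    exact lt_irrefl _ h1
  have hne' : ∀ p ∈ V, 1 - -c * (p.1 ^ 2 * p.2) ≠ 0 := by
    intro p hp h
    have h1 := hp.2
    rw [← norm_neg, ← neg_mul, ← sub_eq_zero.1 h, norm_one] at h1
    exact lt_irrefl _ h1
  have hinv : ∀ p ∈ V, shearMap (-c) (shearMap c p) = p := fun p hp => by
    rw [shearMap_shearMap _ (hne p hp), add_neg_cancel, shearMap_zero]
  have hinv' : ∀ p ∈ V, shearMap c (shearMap (-c) p) = p := fun p hp => by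
    rw [shearMap_shearMap _ (hne' p hp), neg_add_cancel, shearMap_zero]
  have hdiff : ∀ d : ℂ, (∀ p ∈ V, 1 - d * (p.1 ^ 2 * p.2) ≠ 0) →
      DifferentiableOn ℂ (shearMap d) V := by
    intro d hd
    have h1 : DifferentiableOn ℂ (fun p : ℂ × ℂ => p.1) V := by fun_prop
    have h2 : DifferentiableOn ℂ (fun p : ℂ × ℂ => p.2) V := by fun_prop
    have h3 : DifferentiableOn ℂ (fun p : ℂ × ℂ => 1 - d * (p.1 ^ 2 * p.2)) V := by fun_prop
    exact (h1.mul (h3.fun_inv hd)).prodMk (h2.mul h3)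
  refine ⟨V, shearMap c, shearMap (-c), ?_, ?_, isRepresentedBy_shearGerm_iff.2 rfl,
    isRepresentedBy_shearGerm_iff.2 (shearGerm_inv c), hdiff c hne, hdiff (-c) hne',
    LeftInvOn.injOn hinv, LeftInvOn.injOn hinv', fun p hp _ => hinv p hp,
    fun p hp _ => hinv' p hp, ?_⟩
  · have h1 : Continuous fun p : ℂ × ℂ => ‖p.2‖ := by fun_prop
    have h2 : Continuous fun p : ℂ × ℂ => ‖c * (p.1 ^ 2 * p.2)‖ := by fun_prop
    exact (isOpen_lt h1 continuous_const).and (isOpen_lt h2 continuous_const)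
  · simp [hV]
  · intro p hp
    refine (finite_setOf_shearMap_int hc p).subset ?_
    -- The nonvanishing of `1 - ncu` must be carried through the induction, since the composition
    -- law fails at poles, where division returns `0`.
    suffices H : ∀ q, Relation.ReflTransGen
        (fun a b => b ∈ V ∧ (b = shearMap c a ∨ b = shearMap (-c) a)) p q →
        q ∈ V ∧ ∃ n : ℤ, 1 - n * c * (p.1 ^ 2 * p.2) ≠ 0 ∧ q = shearMap (n * c) p from
      fun q hq => let ⟨hqV, n, _, hn⟩ := H q hq; ⟨n, hn, hqV.1⟩
    intro q hq
    induction hq with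
    | refl => exact ⟨hp, 0, by simp, by simp [shearMap_zero]⟩
    | @tail a b _ hab ih =>
      obtain ⟨haV, n, hn, rfl⟩ := ih
      obtain ⟨hbV, hb⟩ := hab
      refine ⟨hbV, ?_⟩
      rcases hb with hb | hb
      · refine ⟨n + 1, ?_, ?_⟩
        · have h := hne _ haV
          rw [one_sub_shearMap_invariant c hn] at h
          have h1 := (div_ne_zero_iff.1 h).1
          push_cast
          rwa [add_one_mul]
        · rw [hb, shearMap_shearMap c hn]
          push_cast
          rw [add_one_mul]
      · refine ⟨n - 1, ?_, ?_⟩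
        · have h := hne' _ haV
          rw [one_sub_shearMap_invariant (-c) hn] at h
          have h1 := (div_ne_zero_iff.1 h).1
          push_cast
          rwa [sub_one_mul, sub_eq_add_neg]
        · rw [hb, shearMap_shearMap (-c) hn]
          push_cast
          rw [sub_one_mul, sub_eq_add_neg]

/-! ### The flow of `fieldX` and the holonomy of the third axis -/

/-- The monomial `x²yz³`. -/
def resonance (p : ℂ × ℂ × ℂ) : ℂ := p.1 ^ 2 * p.2.1 * p.2.2 ^ 3

/-- The flow of `fieldX` in complex time. -/
def flowX (p : ℂ × ℂ × ℂ) (τ : ℂ) : ℂ × ℂ × ℂ :=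
  (p.1 * Complex.exp τ / (1 - resonance p * τ), p.2.1 * Complex.exp τ * (1 - resonance p * τ),
    p.2.2 * Complex.exp (-τ))

theorem flowX_zero (p : ℂ × ℂ × ℂ) : flowX p 0 = p := by simp [flowX]

/-- The exponentials cancel by resonance; what remains is the solution of the Riccati equation `w' =
w²`. -/
theorem resonance_flowX {p : ℂ × ℂ × ℂ} {τ : ℂ} (h : 1 - resonance p * τ ≠ 0) :
    resonance (flowX p τ) = resonance p / (1 - resonance p * τ) := by
  have h1 : Complex.exp τ * Complex.exp (-τ) = 1 := by rw [← Complex.exp_add]; simp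
  have h2 : resonance (flowX p τ) = resonance p * (Complex.exp τ * Complex.exp (-τ)) ^ 3 *
      ((1 - resonance p * τ) ^ 2)⁻¹ * (1 - resonance p * τ) := by
    simp only [flowX]
    generalize 1 - resonance p * τ = m
    simp only [resonance]
    ring
  rw [h2, h1]
  field_simp

theorem hasDerivAt_flowX {p : ℂ × ℂ × ℂ} {τ : ℂ} (h : 1 - resonance p * τ ≠ 0) :
    HasDerivAt (flowX p) (fieldX (flowX p τ)) τ := by
  have hm : HasDerivAt (fun τ => 1 - resonance p * τ) (-resonance p) τ := by
    simpa using ((hasDerivAt_id τ).const_mul (resonance p)).const_sub 1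
  have he := Complex.hasDerivAt_exp τ
  have h1 := (he.const_mul p.1).div hm h
  have h2 := (he.const_mul p.2.1).mul hm
  have h3 := ((hasDerivAt_neg τ).cexp).const_mul p.2.2
  have hw := resonance_flowX h
  have key : fieldX (flowX p τ) = ((flowX p τ).1 * (1 + resonance (flowX p τ)),
      (flowX p τ).2.1 * (1 - resonance (flowX p τ)), -(flowX p τ).2.2) := rfl
  rw [key, hw]
  refine (h1.prodMk (h2.prodMk h3)).congr_deriv (Prod.ext ?_ (Prod.ext ?_ ?_))
  · simp only [flowX]
    generalize hm' : 1 - resonance p * τ = m at h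
    field_simp
    ring
  · simp only [flowX]
    generalize hm' : 1 - resonance p * τ = m at h
    field_simp
    ring
  · simp only [flowX]
    ring

theorem hasDerivAt_flowX_real {p : ℂ × ℂ × ℂ} {T : ℂ} {t : ℝ}
    (h : 1 - resonance p * (T * t) ≠ 0) :
    HasDerivAt (fun s : ℝ => flowX p (T * s)) (T • fieldX (flowX p (T * t))) t := by
  have h1 : HasDerivAt (fun s : ℝ => T * (s : ℂ)) T t := by
    simpa using (Complex.ofRealCLM.hasDerivAt (x := t)).const_mul T
  exact (hasDerivAt_flowX h).scomp t h1

theorem one_sub_ne_zero_of_norm_lt_one {a : ℂ} (h : ‖a‖ < 1) {t : ℝ} (ht : t ∈ Icc (0 : ℝ) 1) :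
    1 - a * t ≠ 0 := by
  intro h0
  have h1 : ‖a * t‖ < 1 := by
    rw [norm_mul, Complex.norm_real, Real.norm_of_nonneg ht.1]
    exact (mul_le_of_le_one_right (norm_nonneg _) ht.2).trans_lt h
  rw [← sub_eq_zero.1 h0, norm_one] at h1
  exact lt_irrefl _ h1

/-- Any lift of the curve `t ↦ exp (-c t)` in the third axis to a leaf is the explicit one. -/
theorem lift_eq_shearMap {c : ℂ} (hc : Complex.exp c = 1) {Γ : ℝ → ℂ × ℂ}
    (hu : ‖(Γ 0).1 ^ 2 * (Γ 0).2 * c‖ < 1)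
    (hΓ : ∀ t ∈ Icc (0 : ℝ) 1, ∃ a : ℂ,
      HasDerivWithinAt (fun s : ℝ => ((Γ s).1, (Γ s).2, Complex.exp (-(c * s))))
        (a • fieldX ((Γ t).1, (Γ t).2, Complex.exp (-(c * t)))) (Icc (0 : ℝ) 1) t) :
    Γ 1 = shearMap c (Γ 0) := by
  set x : ℝ → ℂ := fun t => (Γ t).1 with hx
  set y : ℝ → ℂ := fun t => (Γ t).2 with hy
  set u : ℂ := x 0 ^ 2 * y 0 with hu0
  set e : ℝ → ℂ := fun t => Complex.exp (-(c * t)) with he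
  set w : ℝ → ℂ := fun t => x t ^ 2 * y t * e t ^ 3 with hw
  have hE : ∀ t, HasDerivAt e (-c * e t) t := by
    intro t
    have h1 : HasDerivAt (fun s : ℝ => -(c * (s : ℂ))) (-c) t := by
      simpa using ((Complex.ofRealCLM.hasDerivAt (x := t)).const_mul c).fun_neg
    exact h1.cexp.congr_deriv (mul_comm _ _)
  have hd : ∀ t ∈ Icc (0 : ℝ) 1,
      HasDerivWithinAt x (c * (x t * (1 + w t))) (Icc (0 : ℝ) 1) t ∧
      HasDerivWithinAt y (c * (y t * (1 - w t))) (Icc (0 : ℝ) 1) t := by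
    intro t ht
    obtain ⟨a, ha⟩ := hΓ t ht
    have hud : UniqueDiffWithinAt ℝ (Icc (0 : ℝ) 1) t := uniqueDiffOn_Icc zero_lt_one t ht
    have hone := one_smul ℝ (a • fieldX (x t, y t, e t))
    have h1 : HasDerivWithinAt x (a * (x t * (1 + w t))) (Icc (0 : ℝ) 1) t :=
      ha.hasFDerivWithinAt.fst.hasDerivWithinAt.congr_deriv (congrArg (fun q => q.1) hone)
    have h2 : HasDerivWithinAt y (a * (y t * (1 - w t))) (Icc (0 : ℝ) 1) t :=
      ha.hasFDerivWithinAt.snd.fst.hasDerivWithinAt.congr_deriv (congrArg (fun q => q.2.1) hone)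
    have h3 : HasDerivWithinAt e (a * -e t) (Icc (0 : ℝ) 1) t :=
      ha.hasFDerivWithinAt.snd.snd.hasDerivWithinAt.congr_deriv (congrArg (fun q => q.2.2) hone)
    have h4 := hud.eq_deriv _ h3 (hE t).hasDerivWithinAt
    have hne : e t ≠ 0 := Complex.exp_ne_zero _
    -- The third coordinate is prescribed, which fixes the multiple of the field and leaves a
    -- genuine differential equation for `x` and `y`.
    have hac : a = c := mul_right_cancel₀ hne (by linear_combination -h4)
    rw [hac] at h1 h2
    exact ⟨h1, h2⟩
  have hm : ∀ t, HasDerivAt (fun s : ℝ => 1 - u * c * (s : ℂ)) (-(u * c)) t := by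
    intro t
    simpa using ((Complex.ofRealCLM.hasDerivAt (x := t)).const_mul (u * c)).const_sub 1
  have hwd : ∀ t ∈ Icc (0 : ℝ) 1, HasDerivWithinAt w (c * w t ^ 2) (Icc (0 : ℝ) 1) t := by
    intro t ht
    refine ((((hd t ht).1.fun_pow 2).fun_mul (hd t ht).2).fun_mul
      ((hE t).hasDerivWithinAt.fun_pow 3)).congr_deriv ?_
    have hwt : w t = x t ^ 2 * y t * e t ^ 3 := rfl
    rw [hwt]
    push_cast
    ring
  have hwc : ContinuousOn w (Icc 0 1) := fun t ht => (hwd t ht).continuousWithinAt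
  obtain ⟨K, hK⟩ := isCompact_Icc.exists_bound_of_continuousOn hwc
  -- The defect between `w` and the Riccati solution satisfies a linear homogeneous equation with
  -- zero initial value, so a Grönwall estimate makes it vanish.
  have hDd : ∀ t ∈ Icc (0 : ℝ) 1, HasDerivWithinAt (fun t => w t * (1 - u * c * t) - u)
      (c * w t * (w t * (1 - u * c * t) - u)) (Icc (0 : ℝ) 1) t := by
    intro t ht
    exact (((hwd t ht).fun_mul (hm t).hasDerivWithinAt).sub_const u).congr_deriv (by ring)
  have hD : ∀ t ∈ Icc (0 : ℝ) 1, w t * (1 - u * c * t) - u = 0 := by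
    refine eq_zero_of_abs_deriv_le_mul_abs_self_of_eq_zero_right (K := ‖c‖ * K)
      (f' := fun t => c * w t * (w t * (1 - u * c * t) - u))
      (fun t ht => (hDd t ht).continuousWithinAt)
      (fun t ht => ((hDd t (Ico_subset_Icc_self ht)).mono_of_mem_nhdsWithin
        (Icc_mem_nhdsGE_of_mem ht))) ?_ ?_
    · simp [hw, he, hu0]
    · intro t ht
      rw [norm_mul, norm_mul]
      gcongr
      exact hK t (Ico_subset_Icc_self ht)
  have hne : ∀ t ∈ Icc (0 : ℝ) 1, 1 - u * c * (t : ℂ) ≠ 0 := fun t ht =>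
    one_sub_ne_zero_of_norm_lt_one hu ht
  have hmem1 : (1 : ℝ) ∈ Icc (0 : ℝ) 1 := right_mem_Icc.2 zero_le_one
  have hconst : ∀ f : ℝ → ℂ, (∀ t ∈ Icc (0 : ℝ) 1, HasDerivWithinAt f 0 (Icc (0 : ℝ) 1) t) →
      f 1 = f 0 := fun f hf =>
    constant_of_has_deriv_right_zero (fun t ht => (hf t ht).continuousWithinAt)
      (fun t ht => (hf t (Ico_subset_Icc_self ht)).mono_of_mem_nhdsWithin
        (Icc_mem_nhdsGE_of_mem ht)) 1 hmem1
  have he1 : Complex.exp (-c) = 1 := by rw [Complex.exp_neg, hc, inv_one]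
  -- Undoing the explicit flow on `x`, and likewise on `y` below, gives a function whose derivative
  -- is a multiple of the defect `hD`.
  have hX := hconst (fun t => x t * e t * (1 - u * c * t)) (by
    intro t ht
    refine (((hd t ht).1.fun_mul (hE t).hasDerivWithinAt).fun_mul
      (hm t).hasDerivWithinAt).congr_deriv ?_
    linear_combination (c * x t * e t) * hD t ht)
  have hY := hconst (fun t => y t * e t / (1 - u * c * t)) (by
    intro t ht
    refine (((hd t ht).2.fun_mul (hE t).hasDerivWithinAt).fun_div (hm t).hasDerivWithinAt
      (hne t ht)).congr_deriv ?_
    rw [div_eq_zero_iff]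
    left
    linear_combination (-(c * y t * e t)) * hD t ht)
  have h1 : (1 : ℂ) - u * c ≠ 0 := by simpa using hne 1 hmem1
  simp [he, he1] at hX hY
  have hcu : (1 : ℂ) - c * ((Γ 0).1 ^ 2 * (Γ 0).2) = 1 - u * c := by
    rw [hu0, hx, hy]
    ring
  refine Prod.ext ?_ ?_
  · simp only [shearMap]
    rw [hcu]
    exact eq_div_of_mul_eq h1 hX
  · simp only [shearMap]
    rw [hcu]
    exact (div_eq_iff h1).1 hY

/-- The loop is followed in flow time `ct`, and `exp c = 1` removes the linear part at `t = 1`.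
`lift_eq_shearMap` gives uniqueness, `flowX` existence. -/
theorem isHolonomyGerm_iff {c : ℂ} (hc : Complex.exp c = 1) (g : DiffGerm (ℂ × ℂ)) :
    IsHolonomyGerm fieldX (fun t : ℝ => Complex.exp (-(c * t))) g ↔ g = shearGerm c := by
  have hnhds : ∀ᶠ p : ℂ × ℂ in 𝓝 0, ‖p.1 ^ 2 * p.2 * c‖ < 1 := by
    have h : ContinuousAt (fun p : ℂ × ℂ => ‖p.1 ^ 2 * p.2 * c‖) 0 := by fun_prop
    exact h.eventually_lt continuousAt_const (by simp)
  constructor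
  · rintro ⟨φ, V, Γ, hg, hV, -, -, hΓ⟩
    rw [← isRepresentedBy_shearGerm_iff]
    refine hg.congr ?_
    filter_upwards [hV, hnhds] with p hp hpc
    obtain ⟨h0, h1, h2⟩ := hΓ p hp
    rw [← h1]
    conv_rhs => rw [← h0]
    exact lift_eq_shearMap hc (by rwa [h0]) h2
  · rintro rfl
    have hres : ∀ p : ℂ × ℂ, resonance (p.1, p.2, 1) = p.1 ^ 2 * p.2 := by simp [resonance]
    have hne : ∀ p : ℂ × ℂ, ‖p.1 ^ 2 * p.2 * c‖ < 1 → ∀ t ∈ Icc (0 : ℝ) 1,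
        1 - p.1 ^ 2 * p.2 * (c * t) ≠ 0 := by
      intro p hp t ht
      rw [← mul_assoc]
      exact one_sub_ne_zero_of_norm_lt_one hp ht
    refine ⟨shearMap c, {p | ‖p.1 ^ 2 * p.2 * c‖ < 1},
      fun p t => ((flowX (p.1, p.2, 1) (c * t)).1, (flowX (p.1, p.2, 1) (c * t)).2.1),
      isRepresentedBy_shearGerm_iff.2 rfl, hnhds, ?_, ?_, ?_⟩
    · simp only [flowX, hres]
      refine ContinuousOn.prodMk (ContinuousOn.div (by fun_prop) (by fun_prop) ?_) (by fun_prop)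
      rintro ⟨p, t⟩ ⟨hp, ht⟩
      exact hne p hp t ht
    · intro t _
      simp [flowX]
    · intro p hp
      refine ⟨?_, ?_, ?_⟩
      · simp [flowX_zero]
      · simp [flowX, hres, shearMap, hc, mul_comm c]
      · intro t ht
        refine ⟨c, ?_⟩
        have h := hasDerivAt_flowX_real (p := (p.1, p.2, 1)) (T := c) (t := t)
          (by rw [hres]; exact hne p hp t ht)
        have h3 : ∀ s : ℝ, flowX (p.1, p.2, 1) (c * s) = ((flowX (p.1, p.2, 1) (c * s)).1,
            (flowX (p.1, p.2, 1) (c * s)).2.1, Complex.exp (-(c * s))) := by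
          intro s
          simp [flowX]
        rw [h3 t, funext h3] at h
        exact h.hasDerivWithinAt

/-! ### The identity theorem for the 2-form `dF ∧ dG` -/

section Identity

variable {E : Type*} [NormedAddCommGroup E] [NormedSpace ℂ E]

/-- Quadratic estimate for the first order Taylor remainder of a bounded holomorphic function. -/
theorem norm_taylor_remainder_le {F : E → ℂ} {p : E} {R M : ℝ} (hR : 0 < R)
    (hF : DifferentiableOn ℂ F (Metric.ball p R)) (hM : ∀ q ∈ Metric.ball p R, ‖F q - F p‖ ≤ M)
    {v : E} (hv : ‖v‖ < R) :
    ‖F (p + v) - F p - fderiv ℂ F p v‖ ≤ 2 * M * (‖v‖ / R) ^ 2 := by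
  have hpd : DifferentiableAt ℂ F p := hF.differentiableAt (Metric.ball_mem_nhds p hR)
  have hM0 : 0 ≤ M := (norm_nonneg _).trans (hM p (Metric.mem_ball_self hR))
  have hd : ‖fderiv ℂ F p‖ ≤ M / R :=
    Complex.norm_fderiv_le_div_of_mapsTo_ball hF
      (fun q hq => mem_closedBall_iff_norm.2 (hM q hq)) hR
  set k : E → ℂ := fun q => F q - F p - fderiv ℂ F p (q - p) with hk
  have hkp : k p = 0 := by simp [hk]
  have hmaps : MapsTo k (Metric.ball p R) (Metric.closedBall (k p) (2 * M)) := by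
    intro q hq
    rw [hkp, mem_closedBall_zero_iff]
    have h1 : ‖fderiv ℂ F p (q - p)‖ ≤ M / R * R :=
      ((fderiv ℂ F p).le_opNorm _).trans
        (mul_le_mul hd (mem_ball_iff_norm.1 hq).le (norm_nonneg _) (by positivity))
    rw [div_mul_cancel₀ _ hR.ne'] at h1
    exact (norm_sub_le _ _).trans (by linarith [hM q hq])
  -- Differentiability makes the remainder vanish beyond first order, so the higher-order Schwarz
  -- lemma yields the factor `(‖v‖ / R) ^ 2`.
  have hlo : (k · - k p) =o[𝓝 p] (fun w => ‖w - p‖ ^ 1) := by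
    simp only [hkp, sub_zero, pow_one]
    exact (hasFDerivAt_iff_isLittleO.1 hpd.hasFDerivAt).norm_right
  have hkd : DifferentiableOn ℂ k (Metric.ball p R) := by fun_prop
  have h := Complex.dist_le_mul_div_pow_of_mapsTo_ball_of_isLittleO (z := p + v) hkd hmaps hlo
    (by simpa using hv)
  simpa [hkp, hk] using h

/-- A directional derivative of a holomorphic function is holomorphic along complex lines. -/
theorem differentiableOn_fderiv_line {F : E → ℂ} {U : Set E} (hU : IsOpen U)
    (hF : DifferentiableOn ℂ F U) (v q w : E) :
    DifferentiableOn ℂ (fun t : ℂ => fderiv ℂ F (q + t • w) v) {t | q + t • w ∈ U} := by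
  intro t₀ ht₀
  refine DifferentiableAt.differentiableWithinAt ?_
  have hcont : ContinuousAt F (q + t₀ • w) := (hF.differentiableAt (hU.mem_nhds ht₀)).continuousAt
  obtain ⟨R, hR, hball⟩ := Metric.eventually_nhds_iff_ball.1
    ((hU.eventually_mem ht₀).and (Metric.tendsto_nhds.1 hcont (1 / 2) (by norm_num)))
  have hline : ContinuousAt (fun s : ℂ => q + s • w) t₀ := by fun_prop
  obtain ⟨ε, hε, hεball⟩ := Metric.eventually_nhds_iff_ball.1
    (hline.eventually_mem (Metric.ball_mem_nhds _ (half_pos hR)))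
  have hsub : ∀ s ∈ Metric.ball t₀ ε, ∀ p ∈ Metric.ball (q + s • w) (R / 2),
      p ∈ Metric.ball (q + t₀ • w) R := by
    intro s hs p hp
    have h1 := hεball s hs
    rw [Metric.mem_ball] at *
    linarith [dist_triangle p (q + s • w) (q + t₀ • w)]
  have hR2 := half_pos hR
  set δ : ℕ → ℂ := fun n => ((1 / ((n : ℝ) + 1) : ℝ) : ℂ) with hδ
  have hδ0 : ∀ n, δ n ≠ 0 := fun n => Complex.ofReal_ne_zero.2 (by positivity)
  have hδt : Tendsto (fun n => ‖δ n‖) atTop (𝓝 0) := by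
    have h := tendsto_one_div_add_atTop_nhds_zero_nat (𝕜 := ℝ)
    refine h.congr fun n => ?_
    rw [hδ, Complex.norm_real, Real.norm_of_nonneg (by positivity)]
  have hsmall : ∀ᶠ n in atTop, ‖δ n • v‖ < R / 2 := by
    have h : Tendsto (fun n => ‖δ n • v‖) atTop (𝓝 0) := by
      simpa [norm_smul] using hδt.mul_const ‖v‖
    exact h.eventually_lt_const hR2
  -- The quadratic remainder makes the difference quotients converge uniformly in `s`, at rate `‖δ
  -- n‖`; a uniform limit of holomorphic functions is holomorphic.
  have hlim : TendstoUniformlyOn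
      (fun n (s : ℂ) => (δ n)⁻¹ * (F (q + s • w + δ n • v) - F (q + s • w)))
      (fun s => fderiv ℂ F (q + s • w) v) atTop (Metric.ball t₀ ε) := by
    rw [Metric.tendstoUniformlyOn_iff]
    intro η hη
    have h1 : Tendsto (fun n => ‖δ n‖ * (2 * 1 * (‖v‖ / (R / 2)) ^ 2)) atTop (𝓝 0) := by
      simpa using hδt.mul_const (2 * 1 * (‖v‖ / (R / 2)) ^ 2)
    filter_upwards [hsmall, h1.eventually_lt_const hη] with n hn hn1 s hs
    refine lt_of_le_of_lt ?_ hn1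
    have hp := Metric.mem_ball_self (x := q + s • w) hR2
    have h2 := norm_taylor_remainder_le (F := F) (p := q + s • w) (M := 1) hR2
      (hF.mono fun p hp => (hball p (hsub s hs p hp)).1)
      (fun p hp' => by
        have ha := (hball p (hsub s hs p hp')).2
        have hb := (hball _ (hsub s hs _ hp)).2
        rw [← dist_eq_norm]
        rw [dist_comm] at hb
        linarith [dist_triangle (F p) (F (q + t₀ • w)) (F (q + s • w))]) hn
    rw [dist_comm, dist_eq_norm]
    have h3 : (δ n)⁻¹ * (F (q + s • w + δ n • v) - F (q + s • w)) - fderiv ℂ F (q + s • w) v =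
        (δ n)⁻¹ * (F (q + s • w + δ n • v) - F (q + s • w) -
          fderiv ℂ F (q + s • w) (δ n • v)) := by
      rw [map_smul, smul_eq_mul, mul_sub _ _ (δ n * _), inv_mul_cancel_left₀ (hδ0 n)]
    rw [h3, norm_mul, norm_inv]
    have hpos : 0 < ‖δ n‖ := norm_pos_iff.2 (hδ0 n)
    rw [inv_mul_le_iff₀ hpos]
    refine h2.trans (le_of_eq ?_)
    rw [norm_smul]
    ring
  refine (hlim.tendstoLocallyUniformlyOn.differentiableOn ?_ Metric.isOpen_ball).differentiableAt
    (Metric.ball_mem_nhds t₀ hε)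
  filter_upwards [hsmall] with n hn s hs
  refine DifferentiableAt.differentiableWithinAt ?_
  have hp := (hball _ (hsub s hs _ (Metric.mem_ball_self hR2))).1
  have hp' := (hball _ (hsub s hs (q + s • w + δ n • v) (by simpa using hn))).1
  have hd := hF.differentiableAt (hU.mem_nhds hp)
  have hd' := hF.differentiableAt (hU.mem_nhds hp')
  have hl : DifferentiableAt ℂ (fun s : ℂ => q + s • w) s := by fun_prop
  have hl' : DifferentiableAt ℂ (fun s : ℂ => q + s • w + δ n • v) s := by fun_prop
  exact ((hd'.comp s hl').sub (hd.comp s hl)).const_mul _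

/-- Identity theorem for functions that are holomorphic along complex lines. -/
theorem eqOn_zero_of_differentiableOn_lines {M : E → ℂ} {U : Set E} (hU : IsOpen U)
    (hUc : IsPreconnected U)
    (hM : ∀ q w, DifferentiableOn ℂ (fun t : ℂ => M (q + t • w)) {t | q + t • w ∈ U})
    {a : E} (ha : a ∈ U) (h0 : ∀ᶠ p in 𝓝 a, M p = 0) : ∀ p ∈ U, M p = 0 := by
  have hsub : U ⊆ {p | ∀ᶠ q in 𝓝 p, M q = 0} := by
    -- The set where `M` vanishes locally is open. It is relatively closed because a ball around a
    -- limit point contains some `q` in the set, and the complex line from `q` to any `b` in the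
    -- ball meets it in a convex set, where the one-variable identity theorem applies.
    refine hUc.subset_of_closure_inter_subset isOpen_setOfPred_eventually_nhds ⟨a, ha, h0⟩ ?_
    rintro p ⟨hp, hpU⟩
    obtain ⟨R, hR, hball⟩ := Metric.isOpen_iff.1 hU p hpU
    obtain ⟨q, hq, hqR⟩ := Metric.mem_closure_iff.1 hp R hR
    have hqR : q ∈ Metric.ball p R := by rwa [Metric.mem_ball, dist_comm]
    filter_upwards [Metric.ball_mem_nhds p hR] with b hb
    have hconv : Convex ℝ {t : ℂ | q + t • (b - q) ∈ Metric.ball p R} := by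
      intro s hs t ht x y hx hy hxy
      have h := convex_ball p R hs ht hx hy hxy
      have he : q + (x • s + y • t) • (b - q) =
          x • (q + s • (b - q)) + y • (q + t • (b - q)) := by
        have hq' : q = x • q + y • q := by rw [← add_smul, hxy, one_smul]
        rw [add_smul, smul_assoc, smul_assoc, smul_add, smul_add]
        nth_rewrite 1 [hq']
        abel
      rwa [mem_ofPred_eq, he]
    have hopen : IsOpen {t : ℂ | q + t • (b - q) ∈ Metric.ball p R} :=
      Metric.isOpen_ball.preimage (f := fun t : ℂ => q + t • (b - q)) (by fun_prop)
    have han : AnalyticOnNhd ℂ (fun t : ℂ => M (q + t • (b - q)))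
        {t : ℂ | q + t • (b - q) ∈ Metric.ball p R} :=
      ((hM q (b - q)).mono fun t ht => hball ht).analyticOnNhd hopen
    have hz : (fun t : ℂ => M (q + t • (b - q))) =ᶠ[𝓝 0] 0 := by
      have hl : Tendsto (fun t : ℂ => q + t • (b - q)) (𝓝 0) (𝓝 q) :=
        Continuous.tendsto' (by fun_prop) _ _ (by simp)
      exact hl.eventually hq
    have h1 := han.eqOn_zero_of_preconnected_of_eventuallyEq_zero hconv.isPreconnected
      (by simpa using hqR) hz (x := 1) (by simpa using hb)
    simpa using h1
  exact fun p hp => (hsub hp).self_of_nhds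

/-- If `dF ∧ dG` vanishes near a point of a connected open set, it vanishes identically. -/
theorem wedge_fderiv_eq_zero {F G : E → ℂ} {U : Set E} (hU : IsOpen U) (hUc : IsPreconnected U)
    (hF : DifferentiableOn ℂ F U) (hG : DifferentiableOn ℂ G U) {a : E} (ha : a ∈ U)
    (h0 : ∀ᶠ p in 𝓝 a, ∀ v w, fderiv ℂ F p v * fderiv ℂ G p w - fderiv ℂ F p w * fderiv ℂ G p v = 0)
    {p : E} (hp : p ∈ U) (v w : E) :
    fderiv ℂ F p v * fderiv ℂ G p w - fderiv ℂ F p w * fderiv ℂ G p v = 0 :=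
  eqOn_zero_of_differentiableOn_lines
    (M := fun p => fderiv ℂ F p v * fderiv ℂ G p w - fderiv ℂ F p w * fderiv ℂ G p v) hU hUc
    (fun q u => ((differentiableOn_fderiv_line hU hF v q u).mul
      (differentiableOn_fderiv_line hU hG w q u)).sub
      ((differentiableOn_fderiv_line hU hF w q u).mul (differentiableOn_fderiv_line hU hG v q u)))
    ha (h0.mono fun _ h => h v w) p hp

/-- For each fixed `w`, the hypothesis is the linear relation `β(w) α - α(w) β = 0`; independence
would force `β = 0`. -/
theorem not_linearIndependent_of_wedge_eq_zero {α β : E →L[ℂ] ℂ}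
    (h : ∀ v w, α v * β w - α w * β v = 0) : ¬ LinearIndependent ℂ ![α, β] := by
  intro hli
  rw [LinearIndependent.pair_iff] at hli
  have hβ : ∀ w, β w = 0 := fun w => (hli (β w) (-α w) (by
    ext v
    simp only [neg_smul, add_apply, neg_apply,
      smul_apply, smul_eq_mul, zero_apply]
    linear_combination h v w)).1
  have h1 := hli 0 1 (by ext v; simp [hβ])
  exact one_ne_zero h1.2

end Identity

/-! ### First integrals of `fieldX` -/

theorem IsFirstIntegralOn.comp_flowX {U : Set (ℂ × ℂ × ℂ)} {F : ℂ × ℂ × ℂ → ℂ}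
    (hF : IsFirstIntegralOn fieldX U F) (hU : IsOpen U) {p : ℂ × ℂ × ℂ} {T : ℂ}
    (hne : ∀ t ∈ Icc (0 : ℝ) 1, 1 - resonance p * (T * t) ≠ 0)
    (hmem : ∀ t ∈ Icc (0 : ℝ) 1, flowX p (T * t) ∈ U) : F (flowX p T) = F p := by
  have hd : ∀ t ∈ Icc (0 : ℝ) 1, HasDerivAt (fun s : ℝ => F (flowX p (T * s))) 0 t := by
    intro t ht
    have h1 := (hF.1.differentiableAt (hU.mem_nhds (hmem t ht))).hasFDerivAt.restrictScalars ℝ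
    have h2 := h1.comp_hasDerivAt t (hasDerivAt_flowX_real (hne t ht))
    refine h2.congr_deriv ?_
    rw [ContinuousLinearMap.coe_restrictScalars', map_smul, hF.2 _ (hmem t ht), smul_zero]
  have h := constant_of_has_deriv_right_zero
    (fun t ht => (hd t ht).continuousAt.continuousWithinAt)
    (fun t ht => (hd t (Ico_subset_Icc_self ht)).hasDerivWithinAt) 1 (right_mem_Icc.2 zero_le_one)
  simpa [flowX_zero] using h

theorem norm_div_one_sub_lt {x s : ℂ} {r : ℝ} (hx : ‖x‖ < r) (hs : ‖s‖ ≤ 1 / 2) :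
    ‖x / (1 - s)‖ < 2 * r := by
  have h1 : 1 / 2 ≤ ‖1 - s‖ := by
    have h := norm_sub_norm_le (1 : ℂ) s
    rw [norm_one] at h
    linarith
  rw [norm_div, div_lt_iff₀ (by linarith)]
  nlinarith [norm_nonneg x]

theorem norm_mul_one_sub_lt {y s : ℂ} {r : ℝ} (hy : ‖y‖ < r) (hs : ‖s‖ ≤ 1 / 2) :
    ‖y * (1 - s)‖ < 2 * r := by
  have h1 : ‖1 - s‖ ≤ 3 / 2 := by
    have h := norm_sub_le (1 : ℂ) s
    rw [norm_one] at h
    linarith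
  rw [norm_mul]
  nlinarith [norm_nonneg y]

/-- The diagonal map `(x, y, z) ↦ (x / (1 - s), y (1 - s), z)`. -/
def diagShear (s : ℂ) (p : ℂ × ℂ × ℂ) : ℂ × ℂ × ℂ := (p.1 / (1 - s), p.2.1 * (1 - s), p.2.2)

theorem diagShear_mem_ball {s : ℂ} (hs : ‖s‖ ≤ 1 / 2) {p : ℂ × ℂ × ℂ} {r : ℝ}
    (hp : p ∈ Metric.ball 0 r) : diagShear s p ∈ Metric.ball 0 (2 * r) := by
  rw [mem_ball_zero_iff, Prod.norm_def, Prod.norm_def, max_lt_iff, max_lt_iff] at *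
  obtain ⟨h1, h2, h3⟩ := hp
  exact ⟨norm_div_one_sub_lt h1 hs, norm_mul_one_sub_lt h2 hs,
    h3.trans (by linarith [(norm_nonneg _).trans_lt h3])⟩

/-- Imaginary time only rotates the coordinates, so the number of turns is irrelevant: the shear
factor alone changes moduli, by at most a factor `2`. -/
theorem flowX_mem_ball {p : ℂ × ℂ × ℂ} {τ : ℂ} (hτ : τ.re = 0) (hs : ‖resonance p * τ‖ ≤ 1 / 2)
    {r : ℝ} (hp : p ∈ Metric.ball 0 r) : flowX p τ ∈ Metric.ball 0 (2 * r) := by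
  have he : ‖Complex.exp τ‖ = 1 := by rw [Complex.norm_exp, hτ, Real.exp_zero]
  have he' : ‖Complex.exp (-τ)‖ = 1 := by
    rw [Complex.norm_exp, Complex.neg_re, hτ, neg_zero, Real.exp_zero]
  have h := diagShear_mem_ball hs
    (p := (p.1 * Complex.exp τ, p.2.1 * Complex.exp τ, p.2.2 * Complex.exp (-τ))) (r := r) (by
      rw [mem_ball_zero_iff] at *
      simpa [Prod.norm_def, he, he'] using hp)
  exact h

theorem scale_mem_ball {p : ℂ × ℂ × ℂ} {r : ℝ} (hp : p ∈ Metric.ball 0 r) {l : ℂ}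
    (hl : ‖l‖ < 2) : (l * p.1, l * p.2.1, p.2.2) ∈ Metric.ball (0 : ℂ × ℂ × ℂ) (2 * r) := by
  rw [mem_ball_zero_iff, Prod.norm_def, Prod.norm_def, max_lt_iff, max_lt_iff] at *
  obtain ⟨h1, h2, h3⟩ := hp
  have hr := (norm_nonneg _).trans_lt h1
  refine ⟨?_, ?_, h3.trans (by linarith)⟩
  · rw [norm_mul]
    nlinarith [norm_nonneg p.1, norm_nonneg l]
  · rw [norm_mul]
    nlinarith [norm_nonneg p.2.1, norm_nonneg l]

/-- A first integral is invariant under the holonomy of all loops around the axis; rescaling `x`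
and `y` turns this into invariance under a continuous family of diagonal maps. -/
theorem IsFirstIntegralOn.comp_diagShear {U : Set (ℂ × ℂ × ℂ)} {F : ℂ × ℂ × ℂ → ℂ}
    (hF : IsFirstIntegralOn fieldX U F) (hU : IsOpen U) {r : ℝ}
    (hr : Metric.ball 0 (2 * (2 * r)) ⊆ U) {p : ℂ × ℂ × ℂ} (hp : p ∈ Metric.ball 0 r) {σ : ℝ}
    (hσ : 0 < σ) (hs : ‖σ * (2 * Real.pi * Complex.I) * resonance p‖ ≤ 1 / 2) :
    F (diagShear (σ * (2 * Real.pi * Complex.I) * resonance p) p) = F p := by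
  set c : ℂ := 2 * Real.pi * Complex.I with hc
  set s : ℂ := σ * c * resonance p with hsdef
  have hr0 : 0 < r := (norm_nonneg _).trans_lt (mem_ball_zero_iff.1 hp)
  set H : ℂ → ℂ := fun l => F (diagShear s (l * p.1, l * p.2.1, p.2.2)) -
    F (l * p.1, l * p.2.1, p.2.2) with hH
  have hHd : DifferentiableOn ℂ H (Metric.ball 0 2) := by
    intro l hl
    have hl' := scale_mem_ball hp (mem_ball_zero_iff.1 hl)
    have h1 := hF.1.differentiableAt (hU.mem_nhds (hr (diagShear_mem_ball hs hl')))
    have h2 := hF.1.differentiableAt (hU.mem_nhds (hr (Metric.ball_subset_ball (by linarith) hl')))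
    have h3 : DifferentiableAt ℂ (fun l : ℂ => (l * p.1, l * p.2.1, p.2.2)) l := by fun_prop
    have h4 : DifferentiableAt ℂ (fun l : ℂ => diagShear s (l * p.1, l * p.2.1, p.2.2)) l := by
      unfold diagShear
      fun_prop
    exact ((h1.comp l h4).sub (h2.comp l h3)).differentiableWithinAt
  -- Scaling `x` and `y` by `l` multiplies the resonance by `l³`. With `l³ = σ / n`, the `n`-fold
  -- loop has shear parameter exactly `s`, independently of `n`.
  set lam : ℕ → ℝ := fun n => (σ / (n : ℝ)) ^ ((3 : ℕ) : ℝ)⁻¹ with hlam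
  have hlam3 : ∀ n, lam n ^ 3 = σ / n := fun n =>
    Real.rpow_inv_natCast_pow (by positivity) (by norm_num)
  have hlamt : Tendsto lam atTop (𝓝 0) := by
    have h := (tendsto_const_div_atTop_nhds_zero_nat σ).rpow_const
      (p := ((3 : ℕ) : ℝ)⁻¹) (Or.inr (by positivity))
    rwa [Real.zero_rpow (by positivity)] at h
  have hz : ∀ᶠ n in atTop, H (lam n) = 0 := by
    filter_upwards [eventually_ge_atTop 1, (tendsto_norm_zero.comp hlamt).eventually_lt_const
      (show (0 : ℝ) < 2 by norm_num)] with n hn hn2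
    have hn0 : (n : ℂ) ≠ 0 := by exact_mod_cast (by omega : n ≠ 0)
    have hl2 : ‖(lam n : ℂ)‖ < 2 := by rw [Complex.norm_real]; exact hn2
    set q : ℂ × ℂ × ℂ := (lam n * p.1, lam n * p.2.1, p.2.2) with hq
    have hqb : q ∈ Metric.ball 0 (2 * r) := scale_mem_ball hp hl2
    have hres : resonance q * (n * c) = s := by
      have h3 : (lam n : ℂ) ^ 3 = σ / n := by exact_mod_cast hlam3 n
      have h4 : resonance q = (lam n : ℂ) ^ 3 * resonance p := by
        simp only [resonance, hq]
        ring
      rw [h4, h3, hsdef]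
      field_simp
    have hrest : ∀ t : ℝ, resonance q * (n * c * t) = s * t := fun t => by
      rw [← mul_assoc, hres]
    have hexp : Complex.exp (n * c) = 1 := Complex.exp_nat_mul_two_pi_mul_I n
    have h := hF.comp_flowX hU (p := q) (T := n * c)
      (fun t ht => by
        rw [hrest]
        exact one_sub_ne_zero_of_norm_lt_one (by linarith) ht)
      (fun t ht => hr (flowX_mem_ball (by simp [hc])
        (by
          rw [hrest, norm_mul, Complex.norm_real, Real.norm_of_nonneg ht.1]
          exact (mul_le_of_le_one_right (norm_nonneg _) ht.2).trans hs) hqb))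
    have hflow : flowX q (n * c) = diagShear s q := by
      simp only [flowX, hres, Complex.exp_neg, hexp, inv_one, mul_one, diagShear]
    rw [hflow] at h
    exact sub_eq_zero.2 h
  have hlamt' : Tendsto (fun n => (lam n : ℂ)) atTop (𝓝[≠] 0) := by
    refine tendsto_nhdsWithin_iff.2 ⟨?_, ?_⟩
    · exact (Complex.continuous_ofReal.tendsto' 0 0 Complex.ofReal_zero).comp hlamt
    · filter_upwards [eventually_ge_atTop 1] with n hn
      have hn0 : (0 : ℝ) < n := by exact_mod_cast hn
      exact Complex.ofReal_ne_zero.2 (Real.rpow_pos_of_pos (by positivity) _).ne'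
  -- The zeros `lam n` of `H` accumulate at `0`, and `l = 1` lies inside the disc of radius `2`.
  have h1 := (hHd.analyticOnNhd Metric.isOpen_ball).eqOn_zero_of_preconnected_of_frequently_eq_zero
    (convex_ball (0 : ℂ) 2).isPreconnected (Metric.mem_ball_self two_pos)
    (hlamt'.frequently hz.frequently) (x := 1) (by simp)
  simpa [hH, sub_eq_zero] using h1

/-- This is the infinitesimal form of `comp_diagShear`: differentiate at `σ = 0`, from the right
since that invariance is stated for `σ > 0`. -/
theorem IsFirstIntegralOn.fderiv_hyperbolic {U : Set (ℂ × ℂ × ℂ)} {F : ℂ × ℂ × ℂ → ℂ}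
    (hF : IsFirstIntegralOn fieldX U F) (hU : IsOpen U) {r : ℝ}
    (hr : Metric.ball 0 (2 * (2 * r)) ⊆ U) {p : ℂ × ℂ × ℂ} (hp : p ∈ Metric.ball 0 r)
    (hw : resonance p ≠ 0) : fderiv ℂ F p (p.1, -p.2.1, 0) = 0 := by
  have hr0 : 0 < r := (norm_nonneg _).trans_lt (mem_ball_zero_iff.1 hp)
  set a : ℂ := 2 * Real.pi * Complex.I * resonance p with ha
  have ha0 : a ≠ 0 := mul_ne_zero Complex.two_pi_I_ne_zero hw
  have hm : HasDerivAt (fun σ : ℝ => 1 - (σ : ℂ) * a) (-a) 0 := by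
    simpa using ((Complex.ofRealCLM.hasDerivAt (x := (0 : ℝ))).mul_const a).const_sub 1
  have hcurve : HasDerivAt (fun σ : ℝ => diagShear (σ * a) p) (a • (p.1, -p.2.1, (0 : ℂ))) 0 := by
    refine (((hasDerivAt_const (0 : ℝ) p.1).fun_div hm (by simp)).prodMk
      ((hm.const_mul p.2.1).prodMk (hasDerivAt_const (0 : ℝ) p.2.2))).congr_deriv ?_
    simp [mul_comm]
  have hp0 : diagShear (((0 : ℝ) : ℂ) * a) p = p := by simp [diagShear]
  have hpU : p ∈ U := hr (Metric.ball_subset_ball (by linarith) hp)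
  have hFd : HasFDerivAt F ((fderiv ℂ F p).restrictScalars ℝ) (diagShear (((0 : ℝ) : ℂ) * a) p) := by
    rw [hp0]
    exact (hF.1.differentiableAt (hU.mem_nhds hpU)).hasFDerivAt.restrictScalars ℝ
  have h1 := (hFd.comp_hasDerivAt 0 hcurve).hasDerivWithinAt (s := Ioi 0)
  have hsmall : ∀ᶠ σ : ℝ in 𝓝[>] 0, ‖(σ : ℂ) * a‖ < 1 / 2 := by
    have h : ContinuousAt (fun σ : ℝ => ‖(σ : ℂ) * a‖) 0 := by fun_prop
    exact (h.eventually_lt continuousAt_const (by simp)).filter_mono nhdsWithin_le_nhds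
  have h2 : HasDerivWithinAt (F ∘ fun σ : ℝ => diagShear (σ * a) p) 0 (Ioi 0) 0 := by
    refine (hasDerivWithinAt_const (0 : ℝ) (Ioi 0) (F p)).congr_of_eventuallyEq ?_ ?_
    · filter_upwards [hsmall, self_mem_nhdsWithin] with σ hσ hσ0
      have h := hF.comp_diagShear hU hr hp (σ := σ) hσ0 (by rw [mul_assoc]; exact hσ.le)
      rw [mul_assoc] at h
      exact h
    · show F (diagShear (((0 : ℝ) : ℂ) * a) p) = F p
      rw [hp0]
  have h3 := (uniqueDiffWithinAt_Ioi (0 : ℝ)).eq_deriv _ h1 h2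
  rw [ContinuousLinearMap.coe_restrictScalars', map_smul, smul_eq_mul] at h3
  exact (mul_eq_zero.1 h3).resolve_left ha0

/-- Near the origin and off the coordinate planes, the differential of a first integral is a
multiple of that of `xyz²`. -/
theorem IsFirstIntegralOn.fderiv_eq {U : Set (ℂ × ℂ × ℂ)} {F : ℂ × ℂ × ℂ → ℂ}
    (hF : IsFirstIntegralOn fieldX U F) (hU : IsOpen U) {r : ℝ}
    (hr : Metric.ball 0 (2 * (2 * r)) ⊆ U) {p : ℂ × ℂ × ℂ} (hp : p ∈ Metric.ball 0 r)
    (hx : p.1 ≠ 0) (hy : p.2.1 ≠ 0) (hz : p.2.2 ≠ 0) (v : ℂ × ℂ × ℂ) :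
    fderiv ℂ F p v = fderiv ℂ F p (1, 0, 0) *
      (v.1 + v.2.1 * p.1 / p.2.1 + 2 * v.2.2 * p.1 / p.2.2) := by
  have hr0 : 0 < r := (norm_nonneg _).trans_lt (mem_ball_zero_iff.1 hp)
  have hlin : ∀ v : ℂ × ℂ × ℂ, fderiv ℂ F p v = v.1 * fderiv ℂ F p (1, 0, 0) +
      v.2.1 * fderiv ℂ F p (0, 1, 0) + v.2.2 * fderiv ℂ F p (0, 0, 1) := by
    intro v
    have hv : v = v.1 • ((1, 0, 0) : ℂ × ℂ × ℂ) + v.2.1 • ((0, 1, 0) : ℂ × ℂ × ℂ) +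
        v.2.2 • ((0, 0, 1) : ℂ × ℂ × ℂ) := by
      ext <;> simp
    conv_lhs => rw [hv]
    simp only [map_add, map_smul, smul_eq_mul]
  have hw : resonance p ≠ 0 := by simp [resonance, hx, hy, hz]
  have h1 := hF.fderiv_hyperbolic hU hr hp hw
  have h2 := hF.2 p (hr (Metric.ball_subset_ball (by linarith) hp))
  rw [hlin] at h1 h2 ⊢
  simp only [fieldX] at h1 h2
  generalize fderiv ℂ F p (1, 0, 0) = a at *
  generalize fderiv ℂ F p (0, 1, 0) = b at *
  generalize fderiv ℂ F p (0, 0, 1) = d at *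
  have hb : b = a * p.1 / p.2.1 := by
    rw [eq_div_iff hy]
    linear_combination -h1
  -- The combination used is `X - (w - 1)(x∂x - y∂y) = 2x∂x - z∂z`.
  have hd : d = 2 * a * p.1 / p.2.2 := by
    rw [eq_div_iff hz]
    linear_combination -h2 + (p.1 ^ 2 * p.2.1 * p.2.2 ^ 3 - 1) * h1
  rw [hb, hd]
  ring

theorem not_independentOn_of_isFirstIntegralOn {U : Set (ℂ × ℂ × ℂ)} (hU : IsOpen U)
    (hUc : IsConnected U) (h0 : (0 : ℂ × ℂ × ℂ) ∈ U) {F G : ℂ × ℂ × ℂ → ℂ}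
    (hF : IsFirstIntegralOn fieldX U F) (hG : IsFirstIntegralOn fieldX U G) :
    ¬ IndependentOn U F G := by
  rintro ⟨p, hp, hli⟩
  obtain ⟨R, hR, hball⟩ := Metric.isOpen_iff.1 hU 0 h0
  obtain ⟨r, hr0, rfl⟩ : ∃ r : ℝ, 0 < r ∧ R = 2 * (2 * r) := ⟨R / 4, by linarith, by ring⟩
  -- The point `(e, e, e)` lies in the small ball and off the coordinate planes, where `fderiv_eq`
  -- applies.
  set e : ℂ := ((r / 2 : ℝ) : ℂ) with he
  have he0 : e ≠ 0 := Complex.ofReal_ne_zero.2 (by linarith)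
  have hen : ‖e‖ < r := by
    rw [he, Complex.norm_real, Real.norm_of_nonneg (by linarith)]
    linarith
  have hemem : ((e, e, e) : ℂ × ℂ × ℂ) ∈ Metric.ball 0 r := by
    rw [mem_ball_zero_iff]
    simpa [Prod.norm_def] using hen
  refine not_linearIndependent_of_wedge_eq_zero (fun v w => wedge_fderiv_eq_zero hU
    hUc.isPreconnected hF.1 hG.1 (hball (Metric.ball_subset_ball (by linarith) hemem)) ?_ hp v w)
    hli
  have h1 : ContinuousAt (fun q : ℂ × ℂ × ℂ => q.1) (e, e, e) := by fun_prop
  have h2 : ContinuousAt (fun q : ℂ × ℂ × ℂ => q.2.1) (e, e, e) := by fun_prop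
  have h3 : ContinuousAt (fun q : ℂ × ℂ × ℂ => q.2.2) (e, e, e) := by fun_prop
  filter_upwards [Metric.isOpen_ball.mem_nhds hemem, h1.eventually_ne he0, h2.eventually_ne he0,
    h3.eventually_ne he0] with q hq hx hy hz v w
  rw [hF.fderiv_eq hU hball hq hx hy hz v, hF.fderiv_eq hU hball hq hx hy hz w,
    hG.fderiv_eq hU hball hq hx hy hz v, hG.fderiv_eq hU hball hq hx hy hz w]
  ring

theorem isFirstIntegralOn_monomial :
    IsFirstIntegralOn fieldX univ fun p => p.1 * p.2.1 * p.2.2 ^ 2 := by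
  refine ⟨by fun_prop, fun p _ => ?_⟩
  have h1 : HasFDerivAt (fun p : ℂ × ℂ × ℂ => p.1) (ContinuousLinearMap.fst ℂ ℂ (ℂ × ℂ)) p :=
    hasFDerivAt_fst
  have h2 : HasFDerivAt (fun p : ℂ × ℂ × ℂ => p.2) (ContinuousLinearMap.snd ℂ ℂ (ℂ × ℂ)) p :=
    hasFDerivAt_snd
  have h := (h1.fun_mul h2.fst).fun_mul (h2.snd.pow 2)
  rw [HasFDerivAt.fderiv h]
  simp [fieldX]
  ring

theorem not_eventually_const_monomial :
    ¬ ∃ c : ℂ, ∀ᶠ p : ℂ × ℂ × ℂ in 𝓝 0, p.1 * p.2.1 * p.2.2 ^ 2 = c := by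
  rintro ⟨c, hc⟩
  have hc0 : 0 = c := by simpa using hc.self_of_nhds
  have hcont : Continuous fun t : ℂ => (t, t, t) := by fun_prop
  have ht : Tendsto (fun t : ℂ => (t, t, t)) (𝓝[≠] 0) (𝓝 (0 : ℂ × ℂ × ℂ)) :=
    (hcont.tendsto' 0 0 rfl).mono_left nhdsWithin_le_nhds
  obtain ⟨t, ht1, ht0⟩ := ((ht.eventually hc).and self_mem_nhdsWithin).exists
  have ht0 : t ≠ 0 := ht0
  rw [← hc0] at ht1
  simp [ht0] at ht1

end

theorem mainTheorem5 :
    -- no two independent holomorphic first integrals, on any connected neighbourhood of the origin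
    (¬ ∃ U : Set (ℂ × ℂ × ℂ), IsOpen U ∧ IsConnected U ∧ (0 : ℂ × ℂ × ℂ) ∈ U ∧
      ∃ F G : ℂ × ℂ × ℂ → ℂ, IsFirstIntegralOn fieldX U F ∧ IsFirstIntegralOn fieldX U G ∧
        IndependentOn U F G) ∧
    -- one holomorphic first integral on the whole space, not constant near the origin
    (∃ F : ℂ × ℂ × ℂ → ℂ, IsFirstIntegralOn fieldX Set.univ F ∧
      ¬ ∃ c : ℂ, ∀ᶠ p in 𝓝 (0 : ℂ × ℂ × ℂ), F p = c) ∧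
    -- the holonomy `h` of the loop `z = exp(2πit)`, and that of the reversed loop, which is `h⁻¹`
    ∃ h : DiffGerm (ℂ × ℂ),
      (∀ g : DiffGerm (ℂ × ℂ),
        IsHolonomyGerm fieldX (fun t : ℝ => Complex.exp (2 * Real.pi * Complex.I * t)) g ↔
          g = h) ∧
      (∀ g : DiffGerm (ℂ × ℂ),
        IsHolonomyGerm fieldX (fun t : ℝ => Complex.exp (-(2 * Real.pi * Complex.I * t))) g ↔
          g = h⁻¹) ∧
      HasShearForm h (-(2 * Real.pi * Complex.I)) ∧
      HasShearForm h⁻¹ (2 * Real.pi * Complex.I) ∧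
      h.HasFiniteOrbits ∧ h⁻¹.HasFiniteOrbits ∧
      (Subgroup.zpowers h : Set (DiffGerm (ℂ × ℂ))).Infinite ∧
      ¬ IsOfFinOrder h := by
  have hc0 : (2 * Real.pi * Complex.I : ℂ) ≠ 0 := Complex.two_pi_I_ne_zero
  have he : Complex.exp (2 * Real.pi * Complex.I) = 1 := Complex.exp_two_pi_mul_I
  have he' : Complex.exp (-(2 * Real.pi * Complex.I)) = 1 := by rw [Complex.exp_neg, he, inv_one]
  have hinv : (shearGerm (-(2 * Real.pi * Complex.I)))⁻¹ = shearGerm (2 * Real.pi * Complex.I) := by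
    rw [shearGerm_inv, neg_neg]
  refine ⟨?_, ⟨_, isFirstIntegralOn_monomial, not_eventually_const_monomial⟩,
    -- The minus sign comes from `z = exp(-τ)`: a positive turn takes flow time `-2πi`.
    shearGerm (-(2 * Real.pi * Complex.I)), ?_, ?_, hasShearForm_shearGerm _, ?_,
    hasFiniteOrbits_shearGerm (neg_ne_zero.2 hc0), ?_,
    infinite_zpowers.2 (not_isOfFinOrder_shearGerm (neg_ne_zero.2 hc0)),
    not_isOfFinOrder_shearGerm (neg_ne_zero.2 hc0)⟩
  · rintro ⟨U, hU, hUc, h0, F, G, hF, hG, hFG⟩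
    exact not_independentOn_of_isFirstIntegralOn hU hUc h0 hF hG hFG
  · intro g
    have h := isHolonomyGerm_iff he' g
    simpa only [neg_mul, neg_neg] using h
  · intro g
    rw [hinv]
    exact isHolonomyGerm_iff he g
  · rw [hinv]
    exact hasShearForm_shearGerm _
  · rw [hinv]
    exact hasFiniteOrbits_shearGerm hc0
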